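/- **Theorem.** Let $G$ be a finite group, $p$ a prime dividing $|G|$, and $P$ a Sylow $p$-subgroup of $G$. Let $\Omega=\Omega_1(Z(P))$ be the subgroup of $P$ generated by the elements of order $p$ in the center of $P$. For a finite group $H$ let $r_p(H)$ be the largest integer $r$ such that $H$ has an elementary abelian $p$-subgroup of order $p^r$. Let $\mathcal{A}_p(G)$ be the poset of non-trivial elementary abelian $p$-subgroups of $G$ ordered by inclusion, and let $\mathcal{A}_p(G)'$ be the poset of its non-empty chains, ordered by inclusion. The group $G$ acts on $\mathcal{A}_p(G)'$ by conjugation, and the orbit set $\mathcal{A}_p(G)'/G$ is a finite poset with $\overline{c}\le\overline{d}$ if and only if there are $c_1\in\overline{c}$ and $d_1\in\overline{d}$ with $c_1\le d_1$. View it as a finite topological space whose open sets are the down-sets. If $$r_p(G)-r_p(\Omega)\le 2\qquad\text{and}\qquad r_p(G)\ge \log_p|P|-1,$$ then $\mathcal{A}_p(G)'/G$ is a contractible finite space. -/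

import Mathlib

open scoped Pointwise

namespace WebbPosets

/-! ### Orbit posets -/

section Orbits

variable (G : Type*) (X : Type*) [Group G] [MulAction G X]

/-- The set `X / G` of orbits of a `G`-set `X`. -/
def OrbitSpace : Type _ := MulAction.orbitRel.Quotient G X

instance [Finite X] : Finite (OrbitSpace G X) :=
  inferInstanceAs (Finite (Quotient (MulAction.orbitRel G X)))

variable {X}

/-- The orbit of `x`, as a point of `X / G`. -/
def OrbitSpace.mk (x : X) : OrbitSpace G X := Quotient.mk (MulAction.orbitRel G X) x

variable {G}

theorem OrbitSpace.mk_eq_iff {x y : X} :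
    OrbitSpace.mk G x = OrbitSpace.mk G y ↔ ∃ g : G, g • y = x :=
  (Quotient.eq (r := MulAction.orbitRel G X)).trans Iff.rfl

theorem OrbitSpace.exists_rep (a : OrbitSpace G X) : ∃ x : X, OrbitSpace.mk G x = a :=
  Quotient.exists_rep a

/-- The order of the orbit space of a `G`-poset: `a ≤ b` if some representative of `a` lies below
some representative of `b`. -/
instance [LE X] : LE (OrbitSpace G X) where
  le a b := ∃ x y : X, OrbitSpace.mk G x = a ∧ OrbitSpace.mk G y = b ∧ x ≤ y

/-- In a poset acted on by a finite group, `x ≤ g • x` forces `x = g • x`. -/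
theorem eq_smul_of_le_smul [Finite G] [PartialOrder X] [CovariantClass G X HSMul.hSMul LE.le]
    {g : G} {x : X} (h : x ≤ g • x) : x = g • x := by
  have key : ∀ n : ℕ, g • x ≤ g ^ (n + 1) • x := by
    intro n
    induction n with
    | zero => simp
    | succ n ih =>
      have h2 : g • x ≤ g • (g ^ (n + 1) • x) := CovariantClass.elim g (h.trans ih)
      rwa [smul_smul, ← pow_succ'] at h2
  have h3 := key (orderOf g - 1)
  rw [Nat.sub_add_cancel (orderOf_pos g), pow_orderOf_eq_one, one_smul] at h3
  exact le_antisymm h h3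

/-- The orbit space of a poset under a finite group acting by order automorphisms is a poset. -/
instance [Finite G] [PartialOrder X] [CovariantClass G X HSMul.hSMul LE.le] :
    PartialOrder (OrbitSpace G X) where
  le_refl a := by
    obtain ⟨x, rfl⟩ := a.exists_rep
    exact ⟨x, x, rfl, rfl, le_rfl⟩
  le_trans a b c := by
    rintro ⟨x, y, rfl, rfl, hxy⟩ ⟨y', z, hy, rfl, hyz⟩
    obtain ⟨g, rfl⟩ := OrbitSpace.mk_eq_iff.mp hy.symm
    exact ⟨x, g • z, rfl, OrbitSpace.mk_eq_iff.mpr ⟨g, rfl⟩,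
      hxy.trans (CovariantClass.elim g hyz)⟩
  le_antisymm a b := by
    rintro ⟨x, y, rfl, rfl, hxy⟩ ⟨y', x', hy, hx, hyx⟩
    obtain ⟨g, rfl⟩ := OrbitSpace.mk_eq_iff.mp hy
    obtain ⟨h, rfl⟩ := OrbitSpace.mk_eq_iff.mp hx
    have h1 : g • x ≤ h • x := (CovariantClass.elim g hxy).trans hyx
    have h2 : x ≤ g⁻¹ • h • x := by
      have := CovariantClass.elim (μ := (HSMul.hSMul : G → X → X)) (r := LE.le) g⁻¹ h1
      rwa [inv_smul_smul] at this
    rw [smul_smul] at h2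
    have h3 := eq_smul_of_le_smul h2
    have h4 : g • x = h • x := by
      conv_lhs => rw [h3]
      rw [smul_smul, mul_inv_cancel_left]
    have h5 : g • y = g • x :=
      le_antisymm (hyx.trans h4.symm.le) (CovariantClass.elim g hxy)
    exact congrArg _ ((MulAction.injective g h5).symm)

end Orbits

/-! ### The subdivision of a poset, and the induced action on it -/

section Subdivision

variable {G X : Type*} [Group G] [PartialOrder X] [MulAction G X]
  [CovariantClass G X HSMul.hSMul LE.le]

/-- The action `g • {x₀ < ⋯ < xₙ} = {g • x₀ < ⋯ < g • xₙ}` on the nonempty chains of a `G`-poset;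
the order on `NonemptyChain X` is inclusion. -/
instance : MulAction G (NonemptyChain X) where
  smul g c :=
    { carrier := g • c.carrier
      Nonempty' := c.Nonempty'.smul_set
      isChain' := by
        rintro _ ⟨x, hx, rfl⟩ _ ⟨y, hy, rfl⟩ hne
        have hxy : x ≠ y := fun h => hne (by rw [h])
        exact (c.isChain' hx hy hxy).imp (fun h => CovariantClass.elim g h)
          (fun h => CovariantClass.elim g h) }
  one_smul c := NonemptyChain.ext (one_smul G c.carrier)
  mul_smul g h c := NonemptyChain.ext (mul_smul g h c.carrier)

instance : CovariantClass G (NonemptyChain X) HSMul.hSMul LE.le where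
  elim g _ _ h := Set.smul_set_mono (a := g) h

instance [Finite X] : Finite (NonemptyChain X) :=
  Finite.of_injective (NonemptyChain.carrier (α := X)) fun _ _ => NonemptyChain.ext

end Subdivision

/-! ### Elementary abelian `p`-subgroups -/

section Groups

variable (p : ℕ) (G : Type*) [Group G]

variable {G} in
/-- `A` is an elementary abelian `p`-subgroup (possibly trivial): it is abelian, and all its
elements satisfy `x ^ p = 1`. -/
def IsElementaryAbelian (A : Subgroup G) : Prop :=
  (∀ x ∈ A, ∀ y ∈ A, x * y = y * x) ∧ ∀ x ∈ A, x ^ p = 1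

/-- The poset `𝒜_p(G)` of nontrivial elementary abelian `p`-subgroups of `G`, ordered by
inclusion. -/
def ElemAbelianPoset : Type _ := {A : Subgroup G // IsElementaryAbelian p A ∧ A ≠ ⊥}

instance : PartialOrder (ElemAbelianPoset p G) :=
  inferInstanceAs (PartialOrder {A : Subgroup G // IsElementaryAbelian p A ∧ A ≠ ⊥})

instance [Finite G] : Finite (ElemAbelianPoset p G) :=
  inferInstanceAs (Finite {A : Subgroup G // IsElementaryAbelian p A ∧ A ≠ ⊥})

variable {p G} in
theorem IsElementaryAbelian.conj {A : Subgroup G} (h : IsElementaryAbelian p A) (g : G) :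
    IsElementaryAbelian p (MulAut.conj g • A) := by
  constructor
  · rintro _ ⟨x, hx, rfl⟩ _ ⟨y, hy, rfl⟩
    change MulAut.conj g x * MulAut.conj g y = MulAut.conj g y * MulAut.conj g x
    rw [← map_mul, ← map_mul, h.1 x hx y hy]
  · rintro _ ⟨x, hx, rfl⟩
    change MulAut.conj g x ^ p = 1
    rw [← map_pow, h.2 x hx, map_one]

/-- `G` acts on `𝒜_p(G)` by conjugation, `g • A = g A g⁻¹`. -/
instance : MulAction G (ElemAbelianPoset p G) where
  smul g A := ⟨MulAut.conj g • A.1, A.2.1.conj g, fun h => A.2.2 (by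
    rw [← inv_smul_smul (MulAut.conj g) A.1, h, Subgroup.smul_bot])⟩
  one_smul A := Subtype.ext (by
    change MulAut.conj (1 : G) • A.1 = A.1
    rw [map_one, one_smul])
  mul_smul g h A := Subtype.ext (by
    change MulAut.conj (g * h) • A.1 = MulAut.conj g • MulAut.conj h • A.1
    rw [map_mul, mul_smul])

instance : CovariantClass G (ElemAbelianPoset p G) HSMul.hSMul LE.le where
  elim g _ _ h := Subgroup.pointwise_smul_le_pointwise_smul_iff (a := MulAut.conj g) |>.mpr h

/-- The `p`-rank `r_p(G)` of a finite group `G`: the largest `r` such that `G` has an elementary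
abelian `p`-subgroup of order `p ^ r`. -/
noncomputable def pRank : ℕ :=
  sSup {r : ℕ | ∃ A : Subgroup G, IsElementaryAbelian p A ∧ Nat.card A = p ^ r}

/-- For `p` prime and `G` finite the set of ranks has a maximum, and `pRank` is that maximum. -/
theorem isGreatest_pRank [Fact p.Prime] [Finite G] :
    IsGreatest {r : ℕ | ∃ A : Subgroup G, IsElementaryAbelian p A ∧ Nat.card A = p ^ r}
      (pRank p G) := by
  have hbdd : BddAbove {r : ℕ | ∃ A : Subgroup G,
      IsElementaryAbelian p A ∧ Nat.card A = p ^ r} := by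
    refine ⟨Nat.card G, ?_⟩
    rintro r ⟨A, -, hA⟩
    have h1 : r < p ^ r := Nat.lt_pow_self (Fact.out : p.Prime).one_lt
    have h2 : Nat.card A ≤ Nat.card G := Nat.le_of_dvd Nat.card_pos A.card_subgroup_dvd_card
    omega
  have hne : {r : ℕ | ∃ A : Subgroup G,
      IsElementaryAbelian p A ∧ Nat.card A = p ^ r}.Nonempty :=
    ⟨0, ⊥, ⟨by simp, by simp⟩, by simp⟩
  exact ⟨Nat.sSup_mem hne hbdd, fun _ hr => le_csSup hbdd hr⟩

variable {p G} in
/-- `Ω = Ω₁(Z(P))`: the subgroup of `P` generated by the central elements of `P` of order `p`. -/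
def sylowOmega (P : Sylow p G) : Subgroup P :=
  Subgroup.closure {x : P | x ∈ Subgroup.center P ∧ orderOf x = p}

/-- The finite space `𝒜_p(G)' / G`: the poset of `G`-orbits of nonempty chains of `𝒜_p(G)`, with
the topology whose open sets are the down-sets. -/
abbrev ElemAbelianOrbitSpace [Finite G] : Type _ :=
  Topology.WithLowerSet (OrbitSpace G (NonemptyChain (ElemAbelianPoset p G)))

end Groups

end WebbPosets

/-! For the topology of down-sets, comparable monotone maps of posets are homotopic. Hence a
monotone self-map of an orbit poset lying above or below the identity reduces contractibility to any
subposet containing its image. Three such maps shrink the space to one with a minimum. The rank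
bound is used in one form: every Sylow subgroup `P` has an elementary abelian subgroup `V` of index
at most `p`. So if an elementary abelian `M ≤ P` is not inside `Ω₁(Z(P))`, then `C_P(M)` is
elementary abelian (`isElementaryAbelian_inf_centralizer`). If the top member `m` of a chain is not
subcentral, adjoin a Sylow subgroup of `C_G(m)`, which is elementary abelian and centric
(`contractibleSpace_univ`). Then delete all members that are neither subcentral nor centric
(`contractibleSpace_cappedChains`). Such a chain consists of subcentral members and at most one
further member `S` above them. Finally adjoin `Ω₁(Z(P))` for a suitable Sylow subgroup `P`
(`contractibleSpace_reducedChains`). It is well defined up to conjugacy because it equals `S ∩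
C_G(Q)`, with `Q` Sylow in the chain stabilizer (`omegaCenter_eq_inf_centralizer`); without `S`,
Sylow's theorem in that stabilizer suffices. The subgroups `Ω₁(Z(P))` are all conjugate, so the
orbit of the singleton chain `{Ω₁(Z(P))}` is the minimum of what remains. -/

namespace WebbPosets

open Topology

/-! ### Homotopies between monotone maps -/

section FiniteSpaces

/-- Comparable monotone maps are homotopic for the lower set topologies. -/
theorem homotopic_of_le {α β : Type*} [Preorder α] [Preorder β] {f g : α →o β} (h : f ≤ g) :
    (WithLowerSet.map f).Homotopic (WithLowerSet.map g) := by
  classical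
  -- The homotopy is `f` for `t < 1` and jumps to `g` at `t = 1`. It is continuous because a
  -- down-set containing `g x` contains `f x`.
  refine ⟨⟨⟨fun tx => if tx.1 < 1 then WithLowerSet.map f tx.2 else WithLowerSet.map g tx.2, ?_⟩,
    fun x => ?_, fun x => ?_⟩⟩
  · refine continuous_def.2 fun U hU => ?_
    have hUl : IsLowerSet (WithLowerSet.toLowerSet ⁻¹' U) :=
      WithLowerSet.isLowerSet_toLowerSet_preimage.2 hU
    have hset : (fun tx : unitInterval × WithLowerSet α =>
        if tx.1 < 1 then WithLowerSet.map f tx.2 else WithLowerSet.map g tx.2) ⁻¹' U =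
        (Set.Iio 1 ×ˢ (WithLowerSet.map f ⁻¹' U)) ∪ (Set.univ ×ˢ (WithLowerSet.map g ⁻¹' U)) := by
      ext ⟨t, x⟩
      have hx : WithLowerSet.map g x ∈ U → WithLowerSet.map f x ∈ U := fun hg =>
        hUl (h x) hg
      by_cases ht : t < 1
      · simp only [Set.mem_preimage, ht, if_true, Set.mem_union, Set.mem_prod, Set.mem_Iio,
          true_and, Set.mem_univ]
        exact ⟨Or.inl, fun h => h.elim id hx⟩
      · simp only [Set.mem_preimage, ht, if_false, Set.mem_union, Set.mem_prod, Set.mem_Iio,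
          false_and, Set.mem_univ, true_and, false_or]
    rw [hset]
    exact (isOpen_Iio.prod (hU.preimage (WithLowerSet.map f).continuous)).union
      (isOpen_univ.prod (hU.preimage (WithLowerSet.map g).continuous))
  · simp
  · simp

/-- The identity is homotopic to `i ∘ F`, which factors through a contractible space; nothing is
needed about `F ∘ i`. -/
theorem contractibleSpace_of_comparable {α β : Type*} [Preorder α] [Preorder β]
    (F : α →o β) (i : β →o α)
    (h : OrderHom.id ≤ i.comp F ∨ i.comp F ≤ OrderHom.id)
    (hβ : ContractibleSpace (WithLowerSet β)) : ContractibleSpace (WithLowerSet α) := by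
  rw [contractible_iff_id_nullhomotopic]
  have h1 : (ContinuousMap.id (WithLowerSet α)).Homotopic (WithLowerSet.map (i.comp F)) := by
    have hid : ContinuousMap.id (WithLowerSet α) = WithLowerSet.map (OrderHom.id (α := α)) := rfl
    rw [hid]
    exact h.elim homotopic_of_le fun h => (homotopic_of_le h).symm
  have h2 : (WithLowerSet.map (i.comp F)).Nullhomotopic :=
    ((id_nullhomotopic (WithLowerSet β)).comp_right (WithLowerSet.map i)).comp_left
      (WithLowerSet.map F)
  obtain ⟨y, hy⟩ := h2
  exact ⟨y, h1.trans hy⟩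

theorem contractibleSpace_of_bot {α : Type*} [Preorder α] (a : α) (h : ∀ x, a ≤ x) :
    ContractibleSpace (WithLowerSet α) := by
  rw [contractible_iff_id_nullhomotopic]
  exact ⟨a, (homotopic_of_le (f := OrderHom.const α a) (g := OrderHom.id) h).symm⟩

end FiniteSpaces

/-! ### Multivalued retractions on orbit posets -/

section OrbitSubposets

variable {G X : Type*} [Group G] [Finite G] [PartialOrder X] [MulAction G X]
  [CovariantClass G X HSMul.hSMul LE.le]

/-- The orbits of the elements of a set. -/
def orbitSub (G : Type*) {X : Type*} [Group G] [MulAction G X] (Z : Set X) :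
    Set (OrbitSpace G X) := {q | ∃ c ∈ Z, OrbitSpace.mk G c = q}

/-- A relation between elements of a `G`-poset which is total and monotone on `Z`, equivariant,
single-valued up to the action and contained in `≤` or in `≥` reduces contractibility of `Z / G` to
contractibility of the orbit poset of its values. -/
theorem contractibleSpace_orbitSub (Z Z' : Set X) (hZ' : Z' ⊆ Z)
    (hZ : ∀ (g : G) (c : X), c ∈ Z → g • c ∈ Z) (R : X → X → Prop)
    (tot : ∀ c ∈ Z, ∃ d ∈ Z', R c d)
    (uniq : ∀ c ∈ Z, ∀ d d', R c d → R c d' → OrbitSpace.mk G d = OrbitSpace.mk G d')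
    (inv : ∀ (g : G) (c d : X), R c d → R (g • c) (g • d))
    (mono : ∀ c ∈ Z, ∀ c' ∈ Z, c ≤ c' → ∀ d', R c' d' → ∃ d, R c d ∧ d ≤ d')
    (comp : (∀ c ∈ Z, ∀ d, R c d → c ≤ d) ∨ (∀ c ∈ Z, ∀ d, R c d → d ≤ c))
    (h : ContractibleSpace (WithLowerSet (orbitSub G Z'))) :
    ContractibleSpace (WithLowerSet (orbitSub G Z)) := by
  choose! f hfZ hfR using tot
  let rep : orbitSub G Z → X := fun q => q.2.choose
  have hrepZ : ∀ q, rep q ∈ Z := fun q => q.2.choose_spec.1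
  have hrep : ∀ q, OrbitSpace.mk G (rep q) = q.1 := fun q => q.2.choose_spec.2
  let F : orbitSub G Z → orbitSub G Z' := fun q =>
    ⟨OrbitSpace.mk G (f (rep q)), f (rep q), hfZ _ (hrepZ q), rfl⟩
  -- The value at an orbit may be computed from any representative and any related element: `inv`
  -- moves the representative, `uniq` absorbs the choice.
  have hF : ∀ (q : orbitSub G Z) (c d : X), OrbitSpace.mk G c = q.1 → R c d →
      (F q).1 = OrbitSpace.mk G d := by
    intro q c d hc hd
    obtain ⟨g, hg⟩ := OrbitSpace.mk_eq_iff.1 ((hrep q).trans hc.symm)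
    have h1 := inv g c d hd
    rw [hg] at h1
    rw [show OrbitSpace.mk G d = OrbitSpace.mk G (g • d) from
      OrbitSpace.mk_eq_iff.2 ⟨g⁻¹, inv_smul_smul g d⟩]
    exact uniq _ (hrepZ q) _ _ (hfR _ (hrepZ q)) h1
  have hmem : ∀ (q : orbitSub G Z) (c : X), OrbitSpace.mk G c = q.1 → c ∈ Z := by
    intro q c hc
    obtain ⟨g, hg⟩ := OrbitSpace.mk_eq_iff.1 (hc.trans (hrep q).symm)
    rw [← hg]
    exact hZ g _ (hrepZ q)
  have hFmono : Monotone F := by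
    intro q q' hqq
    obtain ⟨x, y, hx, hy, hxy⟩ := hqq
    obtain ⟨d, hd, hdle⟩ := mono x (hmem q x hx) y (hmem q' y hy) hxy (f y) (hfR y (hmem q' y hy))
    change (F q).1 ≤ (F q').1
    rw [hF q x d hx hd, hF q' y (f y) hy (hfR y (hmem q' y hy))]
    exact ⟨d, f y, rfl, rfl, hdle⟩
  let i : orbitSub G Z' → orbitSub G Z := fun q =>
    ⟨q.1, q.2.choose, hZ' q.2.choose_spec.1, q.2.choose_spec.2⟩
  refine contractibleSpace_of_comparable ⟨F, hFmono⟩ ⟨i, fun a b hab => hab⟩ ?_ h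
  refine comp.imp (fun hc q => ?_) (fun hc q => ?_)
  · change q.1 ≤ OrbitSpace.mk G (f (rep q))
    exact ⟨rep q, f (rep q), hrep q, rfl, hc _ (hrepZ q) _ (hfR _ (hrepZ q))⟩
  · change OrbitSpace.mk G (f (rep q)) ≤ q.1
    exact ⟨f (rep q), rep q, rfl, hrep q, hc _ (hrepZ q) _ (hfR _ (hrepZ q))⟩

theorem contractibleSpace_orbitSpace
    (h : ContractibleSpace (WithLowerSet (orbitSub G (Set.univ : Set X)))) :
    ContractibleSpace (WithLowerSet (OrbitSpace G X)) := by
  refine contractibleSpace_of_comparable (β := orbitSub G (Set.univ : Set X))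
    ⟨fun q => ⟨q, q.exists_rep.choose, trivial, q.exists_rep.choose_spec⟩, fun a b hab => hab⟩
    ⟨Subtype.val, fun a b hab => hab⟩ (Or.inl fun q => le_rfl) h

end OrbitSubposets

/-! ### Sylow subgroups of subgroups, and `Ω₁` of the center -/

section Sylow

variable {p : ℕ} {G : Type*} [Group G]

/-- `S` is a maximal `p`-subgroup of the subgroup `K`. -/
def IsSylowIn (p : ℕ) (K S : Subgroup G) : Prop :=
  Maximal (fun T : Subgroup G => IsPGroup p T ∧ T ≤ K) S

theorem mem_aut_smul_iff {a : MulAut G} {H : Subgroup G} {x : G} : x ∈ a • H ↔ a⁻¹ x ∈ H :=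
  Subgroup.mem_pointwise_smul_iff_inv_smul_mem

theorem isPGroup_aut_smul (a : MulAut G) {H : Subgroup G} (h : IsPGroup p H) :
    IsPGroup p (a • H : Subgroup G) :=
  h.of_equiv (Subgroup.equivSMul a H)

theorem IsSylowIn.aut_smul (a : MulAut G) {K S : Subgroup G} (h : IsSylowIn p K S) :
    IsSylowIn p (a • K) (a • S) := by
  refine ⟨⟨isPGroup_aut_smul a h.prop.1, Subgroup.pointwise_smul_le_pointwise_smul_iff.2 h.prop.2⟩,
    fun T hT hST => ?_⟩
  rw [Subgroup.subset_pointwise_smul_iff]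
  refine h.le_of_ge ⟨isPGroup_aut_smul _ hT.1, ?_⟩ ?_
  · rw [← Subgroup.subset_pointwise_smul_iff]
    exact hT.2
  · rw [← Subgroup.pointwise_smul_subset_iff]
    exact hST

theorem isSylowIn_top (P : Sylow p G) : IsSylowIn p ⊤ (P : Subgroup G) :=
  ⟨⟨P.2, le_top⟩, fun _ hT hPT => (P.3 hT.1 hPT).le⟩

theorem exists_isSylowIn_ge [Finite G] {K T : Subgroup G} (hT : IsPGroup p T) (hTK : T ≤ K) :
    ∃ S, IsSylowIn p K S ∧ T ≤ S := by
  obtain ⟨S, hTS, hS⟩ := Finite.exists_le_maximal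
    (p := fun T : Subgroup G => IsPGroup p T ∧ T ≤ K) ⟨hT, hTK⟩
  exact ⟨S, hS, hTS⟩

theorem IsSylowIn.mono {K L S : Subgroup G} (h : IsSylowIn p L S) (hKL : K ≤ L) (hS : S ≤ K) :
    IsSylowIn p K S :=
  ⟨⟨h.prop.1, hS⟩, fun _ hT hST => h.le_of_ge ⟨hT.1, hT.2.trans hKL⟩ hST⟩

theorem IsSylowIn.exists_conj [Fact p.Prime] [Finite G] {K S T : Subgroup G}
    (hS : IsSylowIn p K S) (hT : IsSylowIn p K T) : ∃ k ∈ K, MulAut.conj k • S = T := by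
  have key : ∀ {S : Subgroup G}, IsSylowIn p K S →
      ∃ P : Sylow p K, (P : Subgroup K) = S.subgroupOf K := by
    intro S hS
    refine ⟨⟨S.subgroupOf K, hS.prop.1.of_equiv (Subgroup.subgroupOfEquivOfLe hS.prop.2).symm,
      fun {Q} hQ hSQ => le_antisymm ?_ hSQ⟩, rfl⟩
    have h1 : S ≤ Q.map K.subtype := by
      have := Subgroup.map_mono (f := K.subtype) hSQ
      rwa [Subgroup.map_subgroupOf_eq_of_le hS.prop.2] at this
    have h2 := hS.le_of_ge ⟨hQ.map K.subtype, Subgroup.map_subtype_le Q⟩ h1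
    exact fun x hx => h2 (Subgroup.mem_map_of_mem K.subtype hx)
  obtain ⟨P, hP⟩ := key hS
  obtain ⟨Q, hQ⟩ := key hT
  obtain ⟨k, hk⟩ := MulAction.exists_smul_eq K P Q
  refine ⟨k, k.2, ?_⟩
  have hmem : ∀ x : K, (k⁻¹ * x * k : K) ∈ S.subgroupOf K ↔ x ∈ T.subgroupOf K := by
    intro x
    rw [← hQ, ← hk, ← hP, Sylow.coe_subgroup_smul, mem_aut_smul_iff]
    simp [← map_inv]
  ext x
  rw [mem_aut_smul_iff, ← map_inv, MulAut.conj_apply, inv_inv]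
  constructor
  · intro h
    have hx : x ∈ K := by
      have := K.mul_mem (K.mul_mem k.2 (hS.prop.2 h)) (K.inv_mem k.2)
      simpa [mul_assoc] using this
    exact (hmem ⟨x, hx⟩).1 h
  · intro h
    exact (hmem ⟨x, hT.prop.2 h⟩).2 h

/-- `P` is also Sylow in `K`, so `S` is a `K`-conjugate of `P`. -/
theorem IsSylowIn.of_le [Fact p.Prime] [Finite G] {K L P S : Subgroup G} (hP : IsSylowIn p L P)
    (hPK : P ≤ K) (hKL : K ≤ L) (hS : IsSylowIn p K S) : IsSylowIn p L S := by
  obtain ⟨k, hk, rfl⟩ := (hP.mono hKL hPK).exists_conj hS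
  have h := hP.aut_smul (MulAut.conj k)
  rwa [Subgroup.conj_smul_eq_self_of_mem (hKL hk)] at h

/-- `S` normalizes `N`, so `S ⊔ N` is a `p`-subgroup of `K`, and `S` is maximal. -/
theorem IsSylowIn.le_of_normalized {K S N : Subgroup G} (hS : IsSylowIn p K S) (hN : IsPGroup p N)
    (hNK : N ≤ K) (hK : K ≤ Subgroup.normalizer (N : Set G)) : N ≤ S := by
  have h1 : IsPGroup p (S ⊔ N : Subgroup G) :=
    hS.prop.1.to_sup_of_normal_right' hN (hS.prop.2.trans hK)
  exact le_sup_right.trans (hS.le_of_ge ⟨h1, sup_le hS.prop.2 hNK⟩ le_sup_left)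

theorem IsElementaryAbelian.isPGroup {A : Subgroup G} (h : IsElementaryAbelian p A) :
    IsPGroup p A :=
  fun x => ⟨1, Subtype.ext (by simpa using h.2 x x.2)⟩

theorem IsElementaryAbelian.mono {A B : Subgroup G} (h : IsElementaryAbelian p B) (hAB : A ≤ B) :
    IsElementaryAbelian p A :=
  ⟨fun x hx y hy => h.1 x (hAB hx) y (hAB hy), fun x hx => h.2 x (hAB hx)⟩

theorem IsElementaryAbelian.aut_smul {A : Subgroup G} (h : IsElementaryAbelian p A)
    (a : MulAut G) : IsElementaryAbelian p (a • A) := by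
  refine ⟨fun x hx y hy => a⁻¹.injective ?_, fun x hx => a⁻¹.injective ?_⟩
  · rw [mem_aut_smul_iff] at hx hy
    rw [map_mul, map_mul, h.1 _ hx _ hy]
  · rw [mem_aut_smul_iff] at hx
    rw [map_pow, h.2 _ hx, map_one]

theorem IsElementaryAbelian.le_centralizer {A : Subgroup G} (h : IsElementaryAbelian p A) :
    A ≤ Subgroup.centralizer (A : Set G) :=
  fun x hx y hy => h.1 y hy x hx

theorem centralizer_aut_smul (a : MulAut G) (A : Subgroup G) :
    Subgroup.centralizer ((a • A : Subgroup G) : Set G) =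
      a • Subgroup.centralizer (A : Set G) := by
  ext x
  simp only [mem_aut_smul_iff, Subgroup.mem_centralizer_iff, SetLike.mem_coe]
  constructor
  · intro h y hy
    have := h (a y) (by simpa using hy)
    simpa using congrArg (fun w => (a⁻¹ : MulAut G) w) this
  · intro h y hy
    have := h _ hy
    rw [← map_mul, ← map_mul] at this
    exact a⁻¹.injective this

theorem conj_smul_eq_of_mem_centralizer {A : Subgroup G} {g : G}
    (hg : g ∈ Subgroup.centralizer (A : Set G)) : MulAut.conj g • A = A :=
  le_antisymm
    (by
      intro x hx
      rw [mem_aut_smul_iff, ← map_inv, MulAut.conj_apply, inv_inv] at hx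
      have := Subgroup.mem_centralizer_iff.1 hg _ hx
      have h2 : x = g⁻¹ * x * g := by
        exact mul_right_cancel (b := g) (by simpa [mul_assoc] using this.symm)
      rwa [h2])
    (by
      intro x hx
      rw [mem_aut_smul_iff, ← map_inv, MulAut.conj_apply, inv_inv]
      have := Subgroup.mem_centralizer_iff.1 hg _ hx
      rwa [mul_assoc, this, inv_mul_cancel_left])

variable (p) in
/-- The central elements of `H` whose `p`-th power is trivial: `Ω₁(Z(H))` if `H` is a
`p`-group. -/
def omegaCenter (H : Subgroup G) : Subgroup G where
  carrier := {x | x ∈ H ∧ (∀ y ∈ H, x * y = y * x) ∧ x ^ p = 1}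
  one_mem' := ⟨H.one_mem, by simp, by simp⟩
  mul_mem' {a b} ha hb := by
    refine ⟨H.mul_mem ha.1 hb.1, fun y hy => ?_, ?_⟩
    · rw [mul_assoc, hb.2.1 y hy, ← mul_assoc, ha.2.1 y hy, mul_assoc]
    · rw [Commute.mul_pow (ha.2.1 b hb.1), ha.2.2, hb.2.2, one_mul]
  inv_mem' {a} ha := by
    refine ⟨H.inv_mem ha.1, fun y hy => ?_, ?_⟩
    · exact (Commute.inv_left (ha.2.1 y hy) : Commute a⁻¹ y)
    · rw [inv_pow, ha.2.2, inv_one]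

theorem mem_omegaCenter {H : Subgroup G} {x : G} :
    x ∈ omegaCenter p H ↔ x ∈ H ∧ (∀ y ∈ H, x * y = y * x) ∧ x ^ p = 1 := Iff.rfl

theorem isElementaryAbelian_omegaCenter (H : Subgroup G) :
    IsElementaryAbelian p (omegaCenter p H) :=
  ⟨fun _ hx y hy => hx.2.1 y hy.1, fun _ hx => hx.2.2⟩

theorem omegaCenter_aut_smul (a : MulAut G) (H : Subgroup G) :
    omegaCenter p (a • H) = a • omegaCenter p H := by
  ext x
  simp only [mem_aut_smul_iff, mem_omegaCenter]
  refine and_congr_right fun _ => and_congr ?_ ?_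
  · constructor
    · intro h y hy
      have := h (a y) (by simpa using hy)
      simpa using congrArg (fun w => (a⁻¹ : MulAut G) w) this
    · intro h y hy
      have := h _ hy
      rw [← map_mul, ← map_mul] at this
      exact a⁻¹.injective this
  · rw [← map_pow]
    exact (map_eq_one_iff _ a⁻¹.injective).symm

theorem omegaCenter_ne_bot [Fact p.Prime] [Finite G] {H : Subgroup G} (h : IsPGroup p H)
    (hH : H ≠ ⊥) : omegaCenter p H ≠ ⊥ := by
  have : Nontrivial H := (Subgroup.nontrivial_iff_ne_bot H).2 hH
  have hZ : Nontrivial (Subgroup.center H) := h.center_nontrivial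
  obtain ⟨n, hn, hcard⟩ := (h.to_subgroup (Subgroup.center H)).nontrivial_iff_card.1 hZ
  obtain ⟨z, hz⟩ := exists_prime_orderOf_dvd_card' (G := Subgroup.center H) p
    (by rw [hcard]; exact dvd_pow_self p hn.ne')
  intro hbot
  have hzO : ((z : H) : G) ∈ omegaCenter p H := by
    refine ⟨(z : H).2, fun y hy => ?_, ?_⟩
    · have := Subgroup.mem_center_iff.1 z.2 ⟨y, hy⟩
      exact congrArg Subtype.val this.symm
    · have : z ^ p = 1 := hz ▸ pow_orderOf_eq_one z
      exact_mod_cast congrArg (fun w : Subgroup.center H => ((w : H) : G)) this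
  rw [hbot, Subgroup.mem_bot] at hzO
  have hz1 : z = 1 := Subtype.ext (Subtype.ext hzO)
  rw [hz1, orderOf_one] at hz
  exact (Fact.out : p.Prime).one_lt.ne hz

/-! ### `p`-groups with an elementary abelian subgroup of index at most `p` -/

section IndexPrime

variable [Fact p.Prime] [Finite G] {P V : Subgroup G}

theorem index_subgroupOf_eq_one_or_prime (hP : IsPGroup p P) (hVP : V ≤ P)
    (hcard : Nat.card P ≤ p * Nat.card V) :
    (V.subgroupOf P).index = 1 ∨ (V.subgroupOf P).index = p := by
  have hp : p.Prime := Fact.out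
  obtain ⟨n, hn⟩ := hP.index (V.subgroupOf P)
  have h1 := (V.subgroupOf P).card_mul_index
  rw [Nat.card_congr (Subgroup.subgroupOfEquivOfLe hVP).toEquiv] at h1
  have h2 : (V.subgroupOf P).index ≤ p := by
    have : Nat.card V * (V.subgroupOf P).index ≤ Nat.card V * p := by
      rw [h1, mul_comm _ p]; exact hcard
    exact Nat.le_of_mul_le_mul_left this Nat.card_pos
  rw [hn] at h2 ⊢
  have hn1 : n ≤ 1 := by
    by_contra! h
    have := Nat.pow_lt_pow_right hp.one_lt h
    rw [pow_one] at this
    omega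
  interval_cases n <;> simp

theorem normal_subgroupOf_of_card_le (hP : IsPGroup p P) (hVP : V ≤ P)
    (hcard : Nat.card P ≤ p * Nat.card V) : (V.subgroupOf P).Normal := by
  have hp : p.Prime := Fact.out
  rcases index_subgroupOf_eq_one_or_prime hP hVP hcard with h | h
  · rw [Subgroup.index_eq_one.1 h]
    infer_instance
  · apply Subgroup.normal_of_index_eq_minFac_card
    obtain ⟨n, hn⟩ := IsPGroup.iff_card.1 hP
    have hdvd := (V.subgroupOf P).index_dvd_card
    rw [h, hn] at *
    rcases Nat.eq_zero_or_pos n with rfl | hn0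
    · exact absurd (Nat.dvd_one.1 (by simpa using hdvd)) hp.ne_one
    · exact (hp.pow_minFac hn0.ne').symm

/-- `V` is normal of index at most `p`, so no proper subgroup of `P` strictly contains it, and `P =
V⟨y⟩`. -/
theorem exists_mul_zpow_of_card_le (hP : IsPGroup p P) (hVP : V ≤ P)
    (hcard : Nat.card P ≤ p * Nat.card V) {y c : G} (hy : y ∈ P) (hyV : y ∉ V) (hc : c ∈ P) :
    ∃ v ∈ V, ∃ k : ℤ, c = v * y ^ k := by
  have hp : p.Prime := Fact.out
  have hN := normal_subgroupOf_of_card_le hP hVP hcard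
  have htop : V.subgroupOf P ⊔ Subgroup.zpowers ⟨y, hy⟩ = ⊤ := by
    have hlt : V.subgroupOf P ≤ V.subgroupOf P ⊔ Subgroup.zpowers ⟨y, hy⟩ := le_sup_left
    have hdvd := Subgroup.index_dvd_of_le hlt
    rcases index_subgroupOf_eq_one_or_prime hP hVP hcard with h | h
    · rw [h, Nat.dvd_one] at hdvd
      exact Subgroup.index_eq_one.1 hdvd
    · rw [h, Nat.dvd_prime hp] at hdvd
      rcases hdvd with h1 | h1
      · exact Subgroup.index_eq_one.1 h1
      · exfalso
        have h2 := Subgroup.relIndex_mul_index hlt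
        rw [h1, h] at h2
        have h3 : (V.subgroupOf P).relIndex (V.subgroupOf P ⊔ Subgroup.zpowers ⟨y, hy⟩) = 1 :=
          Nat.eq_of_mul_eq_mul_right hp.pos (by rw [h2, one_mul])
        have h4 := (le_sup_right.trans (Subgroup.relIndex_eq_one.1 h3))
          (Subgroup.mem_zpowers (⟨y, hy⟩ : P))
        exact hyV h4
  have hmem : (⟨c, hc⟩ : P) ∈ V.subgroupOf P ⊔ Subgroup.zpowers ⟨y, hy⟩ := by
    rw [htop]; trivial
  obtain ⟨v, hv, w, hw, hvw⟩ := Subgroup.mem_sup_of_normal_left.1 hmem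
  obtain ⟨k, rfl⟩ := Subgroup.mem_zpowers_iff.1 hw
  exact ⟨v, hv, k, by simpa using (congrArg Subtype.val hvw).symm⟩

/-- In a `p`-group with an elementary abelian subgroup of index at most `p`, the centralizer of a
noncentral elementary abelian subgroup is elementary abelian. -/
theorem isElementaryAbelian_inf_centralizer (hP : IsPGroup p P) (hVP : V ≤ P)
    (hcard : Nat.card P ≤ p * Nat.card V) (hV : IsElementaryAbelian p V) {M : Subgroup G}
    (hMP : M ≤ P) (hM : IsElementaryAbelian p M) (hMO : ¬ M ≤ omegaCenter p P) :
    IsElementaryAbelian p (P ⊓ Subgroup.centralizer (M : Set G) : Subgroup G) := by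
  by_cases hMV : M ≤ V
  -- An element `c` of the centralizer outside `V` would give `P = V⟨c⟩`. Then every `m ∈ M` would
  -- be central in `P`, so the centralizer lies in `V`.
  · obtain ⟨m, hm, hmO⟩ := SetLike.not_le_iff_exists.1 hMO
    refine hV.mono fun c hc => ?_
    by_contra hcV
    refine hmO ⟨hMP hm, fun z hz => ?_, hM.2 m hm⟩
    obtain ⟨v, hv, k, rfl⟩ := exists_mul_zpow_of_card_le hP hVP hcard hc.1 hcV hz
    have h1 : Commute m v := hV.1 m (hMV hm) v hv
    have h2 : Commute m c := hc.2 m hm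
    exact h1.mul_right (h2.zpow_right k)
  -- Here `P = V⟨y⟩` with `y ∈ M`, so the centralizer lies in `C_V(y)⟨y⟩`, which is elementary
  -- abelian.
  · obtain ⟨y, hy, hyV⟩ := SetLike.not_le_iff_exists.1 hMV
    have key : ∀ c ∈ P ⊓ Subgroup.centralizer (M : Set G),
        ∃ v ∈ V, ∃ k : ℤ, c = v * y ^ k ∧ Commute v y := by
      intro c hc
      obtain ⟨v, hv, k, hvk⟩ := exists_mul_zpow_of_card_le hP hVP hcard (hMP hy) hyV hc.1
      refine ⟨v, hv, k, hvk, ?_⟩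
      have h1 : Commute c y := ((hc.2 y hy : y * c = c * y) : Commute y c).symm
      have h2 : v = c * (y ^ k)⁻¹ := by rw [hvk]; group
      rw [h2]
      exact h1.mul_left ((Commute.refl y).zpow_left k).inv_left
    refine ⟨fun c hc d hd => ?_, fun c hc => ?_⟩
    · obtain ⟨v, hv, k, rfl, hvy⟩ := key c hc
      obtain ⟨w, hw, l, rfl, hwy⟩ := key d hd
      have hvw : Commute v w := hV.1 v hv w hw
      exact (hvw.mul_right (hvy.zpow_right l)).mul_left
        ((hwy.symm.zpow_left k).mul_right (((Commute.refl y).zpow_left k).zpow_right l))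
    · obtain ⟨v, hv, k, rfl, hvy⟩ := key c hc
      rw [(hvy.zpow_right k).mul_pow, hV.2 v hv, ← zpow_natCast, ← zpow_mul, mul_comm k, zpow_mul,
        zpow_natCast, hM.2 y hy, one_zpow, one_mul]

/-- In a `p`-group with an elementary abelian subgroup of index at most `p`, the elements of a
self-centralizing noncentral elementary abelian subgroup that commute with its normalizer are
central. -/
theorem mem_omegaCenter_of_commute_normalizer (hP : IsPGroup p P) (hVP : V ≤ P)
    (hcard : Nat.card P ≤ p * Nat.card V) (hV : IsElementaryAbelian p V) {S : Subgroup G}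
    (hSP : S ≤ P) (hS : IsElementaryAbelian p S) (hSO : ¬ S ≤ omegaCenter p P)
    (hCS : ∀ x ∈ P, x ∈ Subgroup.centralizer (S : Set G) → x ∈ S) {x : G} (hx : x ∈ S)
    (hxN : ∀ z ∈ P, z ∈ Subgroup.normalizer (S : Set G) → x * z = z * x) :
    x ∈ omegaCenter p P := by
  refine ⟨hSP hx, ?_, hS.2 x hx⟩
  have hN := normal_subgroupOf_of_card_le hP hVP hcard
  by_cases hSV : S ≤ V
  -- Self-centralization forces `S = V`, which is normal in `P`.
  · have hVS : V ≤ S := fun v hv => hCS v (hVP hv) fun s hs => hV.1 s (hSV hs) v hv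
    obtain rfl := le_antisymm hSV hVS
    intro z hz
    exact hxN z hz ((Subgroup.normal_subgroupOf_iff_le_normalizer hVP).1 hN hz)
  obtain ⟨y, hy, hyV⟩ := SetLike.not_le_iff_exists.1 hSV
  by_cases hxV : x ∈ V
  · intro z hz
    obtain ⟨v, hv, k, rfl⟩ := exists_mul_zpow_of_card_le hP hVP hcard (hSP hy) hyV hz
    have h1 : Commute x v := hV.1 x hxV v hv
    have h2 : Commute x y := hS.1 x hx y hy
    exact h1.mul_right (h2.zpow_right k)
  -- Now `P = V⟨x⟩`, and `x` commutes with `N_P(S)`. This makes `N_P(S)` centralize `S`, hence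
  -- `N_P(S) = S`. Normalizers grow in `p`-groups, so `S = P` is abelian and equals `Ω₁(Z(P))`, a
  -- contradiction.
  · exfalso
    have hNS : ∀ z ∈ P, z ∈ Subgroup.normalizer (S : Set G) → z ∈ S := by
      intro z hz hzN
      refine hCS z hz fun s hs => ?_
      obtain ⟨v, hv, k, rfl⟩ := exists_mul_zpow_of_card_le hP hVP hcard (hSP hx) hxV (hSP hs)
      have hxz : Commute x z := hxN z hz hzN
      have hvS : v ∈ S := (S.mul_mem_cancel_right (S.zpow_mem hx k)).1 hs
      have hvx : Commute v x := hS.1 v hvS x hx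
      have hvz : Commute v z := by
        obtain ⟨w, hw, l, rfl⟩ := exists_mul_zpow_of_card_le hP hVP hcard (hSP hx) hxV hz
        have h1 : Commute v w := hV.1 v hv w hw
        exact h1.mul_right (hvx.zpow_right l)
      exact hvz.mul_left (hxz.zpow_left k)
    have hSeq : S = P := by
      by_contra hne
      have : Group.IsNilpotent P := hP.isNilpotent
      have hlt : S.subgroupOf P < ⊤ := by
        rw [lt_top_iff_ne_top, Ne, Subgroup.subgroupOf_eq_top]
        exact fun h => hne (le_antisymm hSP h)
      have h2 := Group.normalizerCondition_of_isNilpotent (G := P) _ hlt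
      obtain ⟨z, hzN, hzS⟩ := SetLike.exists_of_lt h2
      refine hzS (hNS z z.2 ?_)
      rw [Subgroup.mem_normalizer_iff] at hzN ⊢
      intro h
      constructor
      · intro hh
        exact (hzN ⟨h, hSP hh⟩).1 hh
      · intro hh
        have hP' : h ∈ P := by
          have := P.mul_mem (P.mul_mem (P.inv_mem z.2) (hSP hh)) z.2
          simpa [mul_assoc] using this
        exact (hzN ⟨h, hP'⟩).2 hh
    subst hSeq
    exact hSO fun s hs => ⟨hs, fun z hz => hS.1 s hs z hz, hS.2 s hs⟩

end IndexPrime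

/-- Conjugate an elementary abelian subgroup of maximal order `p ^ r` into `Q`; if `|Q| = p ^ n`,
the logarithmic bound says `n ≤ r + 1`. -/
theorem exists_elementaryAbelian_of_logb_le [Fact p.Prime] [Finite G] (P : Sylow p G)
    (hrank : (pRank p G : ℝ) ≥ Real.logb p (Nat.card P) - 1) {Q : Subgroup G}
    (hQ : IsSylowIn p ⊤ Q) :
    ∃ V ≤ Q, IsElementaryAbelian p V ∧ Nat.card Q ≤ p * Nat.card V := by
  have hp : p.Prime := Fact.out
  obtain ⟨A, hA, hAcard⟩ := (isGreatest_pRank p G).1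
  obtain ⟨T, hT, hAT⟩ := exists_isSylowIn_ge hA.isPGroup le_top
  obtain ⟨g, -, hg⟩ := hT.exists_conj hQ
  obtain ⟨k, -, hk⟩ := (isSylowIn_top P).exists_conj hQ
  refine ⟨MulAut.conj g • A, hg ▸ Subgroup.pointwise_smul_le_pointwise_smul_iff.2 hAT,
    hA.conj g, ?_⟩
  rw [← hk, Nat.card_congr (Subgroup.equivSMul (MulAut.conj g) A).toEquiv.symm,
    Nat.card_congr (Subgroup.equivSMul (MulAut.conj k) (P : Subgroup G)).toEquiv.symm, hAcard]
  obtain ⟨n, hn⟩ := IsPGroup.iff_card.1 P.2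
  have hn' : Nat.card P = p ^ n := hn
  rw [hn', Nat.cast_pow, Real.logb_pow, Real.logb_self_eq_one (by exact_mod_cast hp.one_lt),
    mul_one] at hrank
  rw [hn, ← pow_succ']
  refine Nat.pow_le_pow_right hp.pos ?_
  have : (n : ℝ) ≤ (pRank p G + 1 : ℕ) := by push_cast; linarith
  exact_mod_cast this

end Sylow

/-! ### Subcentral and centric subgroups -/

section Types

variable {p : ℕ} {G : Type*} [Group G]

/-- `A` lies in `Ω₁(Z(P))` for some Sylow `p`-subgroup `P`. -/
def IsSubcentral (p : ℕ) (A : Subgroup G) : Prop :=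
  ∃ P, IsSylowIn p ⊤ P ∧ A ≤ omegaCenter p P

/-- `A` contains every `p`-subgroup centralizing it. -/
def IsCentric (p : ℕ) (A : Subgroup G) : Prop :=
  ∀ T : Subgroup G, IsPGroup p T → T ≤ Subgroup.centralizer (A : Set G) → T ≤ A

theorem IsSubcentral.mono {A B : Subgroup G} (h : IsSubcentral p B) (hAB : A ≤ B) :
    IsSubcentral p A :=
  let ⟨P, hP, hB⟩ := h
  ⟨P, hP, hAB.trans hB⟩

theorem IsSylowIn.conj_top {P : Subgroup G} (h : IsSylowIn p ⊤ P) (g : G) :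
    IsSylowIn p ⊤ (MulAut.conj g • P) := by
  have := h.aut_smul (MulAut.conj g)
  rwa [Subgroup.conj_smul_eq_self_of_mem (Subgroup.mem_top g)] at this

theorem isSubcentral_conj_iff {A : Subgroup G} (g : G) :
    IsSubcentral p (MulAut.conj g • A) ↔ IsSubcentral p A := by
  have key : ∀ (g : G) (A : Subgroup G), IsSubcentral p A →
      IsSubcentral p (MulAut.conj g • A) := by
    rintro g A ⟨P, hP, hA⟩
    exact ⟨_, hP.conj_top g, by
      rw [omegaCenter_aut_smul]
      exact Subgroup.pointwise_smul_le_pointwise_smul_iff.2 hA⟩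
  refine ⟨fun h => ?_, key g A⟩
  have := key g⁻¹ _ h
  rwa [map_inv, inv_smul_smul] at this

theorem isCentric_conj_iff {A : Subgroup G} (g : G) :
    IsCentric p (MulAut.conj g • A) ↔ IsCentric p A := by
  have key : ∀ (a : MulAut G) (A : Subgroup G), IsCentric p A → IsCentric p (a • A) := by
    intro a A h T hT hTA
    rw [Subgroup.subset_pointwise_smul_iff]
    refine h _ (isPGroup_aut_smul _ hT) ?_
    rwa [centralizer_aut_smul, Subgroup.subset_pointwise_smul_iff] at hTA
  refine ⟨fun h => ?_, key _ A⟩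
  have := key (MulAut.conj g)⁻¹ _ h
  rwa [inv_smul_smul] at this

theorem centralizer_le_normalizer (A : Subgroup G) :
    Subgroup.centralizer (A : Set G) ≤ Subgroup.normalizer (A : Set G) :=
  Subgroup.centralizer_le_normalizer _

theorem centralizer_anti {A B : Subgroup G} (h : A ≤ B) :
    Subgroup.centralizer (B : Set G) ≤ Subgroup.centralizer (A : Set G) :=
  Subgroup.centralizer_le h

theorem le_centralizer_symm {A B : Subgroup G} (h : A ≤ Subgroup.centralizer (B : Set G)) :
    B ≤ Subgroup.centralizer (A : Set G) :=
  Subgroup.le_centralizer_iff.1 h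

/-- An abelian overgroup of `A` centralizes `A`. -/
theorem IsCentric.eq_of_le {A B : Subgroup G} (hA : IsCentric p A)
    (hB : IsElementaryAbelian p B) (hAB : A ≤ B) : A = B :=
  le_antisymm hAB (hA B hB.isPGroup (hB.le_centralizer.trans (centralizer_anti hAB)))

theorem le_of_isSylowIn_centralizer {M S : Subgroup G} (hM : IsElementaryAbelian p M)
    (hS : IsSylowIn p (Subgroup.centralizer (M : Set G)) S) : M ≤ S :=
  hS.le_of_normalized hM.isPGroup hM.le_centralizer (centralizer_le_normalizer M)

theorem mem_normalizer_iff_conj_smul_eq {A : Subgroup G} {g : G} :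
    g ∈ Subgroup.normalizer (A : Set G) ↔ MulAut.conj g • A = A := by
  rw [← inv_mem_iff, Subgroup.mem_normalizer_iff, SetLike.ext_iff]
  refine forall_congr' fun x => ?_
  rw [mem_aut_smul_iff, ← map_inv, MulAut.conj_apply]
  exact Iff.comm

/-- A Sylow subgroup `U` of `C_G(S)` contains the abelian group `S`, and `C_G(S) ≤ C_G(M)` because
`M ≤ S`. Maximality of `S` in `C_G(M)` gives `U = S`. -/
theorem isCentric_of_isSylowIn_centralizer [Finite G] {M S : Subgroup G} (hM : IsElementaryAbelian p M)
    (hS : IsSylowIn p (Subgroup.centralizer (M : Set G)) S) (hSe : IsElementaryAbelian p S) :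
    IsCentric p S := by
  intro T hT hTS
  obtain ⟨U, hU, hTU⟩ := exists_isSylowIn_ge hT hTS
  have hSU := le_of_isSylowIn_centralizer hSe hU
  exact hTU.trans (hS.le_of_ge ⟨hU.prop.1, hU.prop.2.trans
    (centralizer_anti (le_of_isSylowIn_centralizer hM hS))⟩ hSU)

variable [Fact p.Prime] [Finite G]

/-- Every Sylow `p`-subgroup has an elementary abelian subgroup of index at most `p`. -/
def HasElementaryAbelianOfIndexLE (p : ℕ) (G : Type*) [Group G] : Prop :=
  ∀ Q : Subgroup G, IsSylowIn p ⊤ Q →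
    ∃ V ≤ Q, IsElementaryAbelian p V ∧ Nat.card Q ≤ p * Nat.card V

theorem isElementaryAbelian_of_isSylowIn_centralizer (h : HasElementaryAbelianOfIndexLE p G)
    {M S : Subgroup G} (hM : IsElementaryAbelian p M) (hMs : ¬ IsSubcentral p M)
    (hS : IsSylowIn p (Subgroup.centralizer (M : Set G)) S) : IsElementaryAbelian p S := by
  obtain ⟨P, hP, hSP⟩ := exists_isSylowIn_ge hS.prop.1 (le_top (a := S))
  obtain ⟨V, hVP, hV, hcard⟩ := h P hP
  exact (isElementaryAbelian_inf_centralizer hP.prop.1 hVP hcard hV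
    ((le_of_isSylowIn_centralizer hM hS).trans hSP) hM fun hMO => hMs ⟨P, hP, hMO⟩).mono
    (le_inf hSP hS.prop.2)

/-- A Sylow subgroup `T ≥ S` of `C_G(M)` is abelian and contains `N`, so it already lies in
`C_G(N)`. This makes the adjunction of Sylow subgroups of centralizers monotone in the chain. -/
theorem isSylowIn_centralizer_of_le (h : HasElementaryAbelianOfIndexLE p G) {M N S : Subgroup G}
    (hM : IsElementaryAbelian p M) (hMs : ¬ IsSubcentral p M) (hMN : M ≤ N)
    (hN : IsElementaryAbelian p N) (hS : IsSylowIn p (Subgroup.centralizer (N : Set G)) S) :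
    IsSylowIn p (Subgroup.centralizer (M : Set G)) S := by
  obtain ⟨T, hT, hST⟩ := exists_isSylowIn_ge hS.prop.1 (hS.prop.2.trans (centralizer_anti hMN))
  have hTe := isElementaryAbelian_of_isSylowIn_centralizer h hM hMs hT
  have hNT : N ≤ T := (le_of_isSylowIn_centralizer hN hS).trans hST
  have : T ≤ S :=
    hS.le_of_ge ⟨hT.prop.1, hTe.le_centralizer.trans (centralizer_anti hNT)⟩ hST
  rwa [le_antisymm hST this]

end Types

/-! ### Adjoining a member to a chain -/

section Chains

variable {p : ℕ} {G : Type*} [Group G]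

theorem ElemAbelianPoset.coe_smul (g : G) (A : ElemAbelianPoset p G) :
    (g • A).1 = MulAut.conj g • A.1 := rfl

theorem ElemAbelianPoset.smul_eq_of_mem_centralizer {g : G} {A : ElemAbelianPoset p G}
    (hg : g ∈ Subgroup.centralizer (A.1 : Set G)) : g • A = A :=
  Subtype.ext (conj_smul_eq_of_mem_centralizer hg)

variable {X : Type*} [PartialOrder X]

theorem mem_smul_chain [MulAction G X] [CovariantClass G X HSMul.hSMul LE.le] {g : G}
    {c : NonemptyChain X} {x : X} : x ∈ (g • c).carrier ↔ g⁻¹ • x ∈ c.carrier :=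
  Set.mem_smul_set_iff_inv_smul_mem

theorem carrier_smul [MulAction G X] [CovariantClass G X HSMul.hSMul LE.le] (g : G)
    (c : NonemptyChain X) : (g • c).carrier = g • c.carrier := rfl

theorem _root_.NonemptyChain.comparable (c : NonemptyChain X) {x y : X} (hx : x ∈ c.carrier)
    (hy : y ∈ c.carrier) : x ≤ y ∨ y ≤ x := by
  by_cases h : x = y
  · exact Or.inl h.le
  · exact c.isChain' hx hy h

theorem _root_.NonemptyChain.exists_insert (c : NonemptyChain X) (w : X)
    (h : ∀ x ∈ c.carrier, x ≤ w ∨ w ≤ x) :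
    ∃ d : NonemptyChain X, d.carrier = insert w c.carrier :=
  ⟨⟨insert w c.carrier, Set.insert_nonempty _ _, c.isChain'.insert fun x hx _ =>
    (h x hx).symm⟩, rfl⟩

theorem exists_greatest_of_isChain [Finite X] {s : Set X} (hs : s.Nonempty)
    (hc : ∀ x ∈ s, ∀ y ∈ s, x ≤ y ∨ y ≤ x) : ∃ m ∈ s, ∀ x ∈ s, x ≤ m := by
  obtain ⟨m, hm⟩ := (Set.toFinite s).exists_maximal hs
  exact ⟨m, hm.prop, fun x hx => (hc x hx m hm.prop).elim id fun h => hm.le_of_ge hx h⟩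

theorem mk_eq_of_insert [MulAction G X] [CovariantClass G X HSMul.hSMul LE.le]
    {c d d' : NonemptyChain X} {w : X} (g : G) (hg : ∀ x ∈ c.carrier, g • x = x)
    (hd : d.carrier = insert w c.carrier) (hd' : d'.carrier = insert (g • w) c.carrier) :
    OrbitSpace.mk G d = OrbitSpace.mk G d' := by
  refine (OrbitSpace.mk_eq_iff.2 ⟨g, NonemptyChain.ext ?_⟩).symm
  rw [carrier_smul, hd, hd', Set.smul_set_insert]
  congr 1
  ext x
  rw [Set.mem_smul_set]
  constructor
  · rintro ⟨y, hy, rfl⟩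
    rwa [hg y hy]
  · exact fun hx => ⟨x, hx, hg x hx⟩

end Chains

/-! ### The three retractions and the minimum -/

section Reductions

variable {p : ℕ} {G : Type*} [Group G]

/-- The chains each of whose non-subcentral members lies below a centric non-subcentral member. -/
def cappedChains (p : ℕ) (G : Type*) [Group G] : Set (NonemptyChain (ElemAbelianPoset p G)) :=
  {c | ∀ x ∈ c.carrier, ¬ IsSubcentral p x.1 →
    ∃ y ∈ c.carrier, x ≤ y ∧ ¬ IsSubcentral p y.1 ∧ IsCentric p y.1}

/-- The chains whose members are subcentral or centric. -/
def reducedChains (p : ℕ) (G : Type*) [Group G] : Set (NonemptyChain (ElemAbelianPoset p G)) :=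
  {c | ∀ x ∈ c.carrier, IsSubcentral p x.1 ∨ IsCentric p x.1}

/-- The reduced chains with a member of the form `Ω₁(Z(P))`, `P` a Sylow `p`-subgroup. -/
def omegaChains (p : ℕ) (G : Type*) [Group G] : Set (NonemptyChain (ElemAbelianPoset p G)) :=
  {c | c ∈ reducedChains p G ∧
    ∃ P, IsSylowIn p ⊤ P ∧ ∃ w ∈ c.carrier, w.1 = omegaCenter p P}

theorem isSubcentral_smul_iff {g : G} {x : ElemAbelianPoset p G} :
    IsSubcentral p (g • x).1 ↔ IsSubcentral p x.1 := isSubcentral_conj_iff g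

theorem isCentric_smul_iff {g : G} {x : ElemAbelianPoset p G} :
    IsCentric p (g • x).1 ↔ IsCentric p x.1 := isCentric_conj_iff g

theorem smul_mem_cappedChains (g : G) (c : NonemptyChain (ElemAbelianPoset p G))
    (hc : c ∈ cappedChains p G) : g • c ∈ cappedChains p G := by
  rintro _ ⟨x, hx, rfl⟩ hs
  obtain ⟨y, hy, hxy, hys, hyc⟩ := hc x hx (mt isSubcentral_smul_iff.2 hs)
  exact ⟨g • y, Set.smul_mem_smul_set hy, CovariantClass.elim g hxy,
    mt isSubcentral_smul_iff.1 hys, isCentric_smul_iff.2 hyc⟩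

theorem smul_mem_reducedChains (g : G) (c : NonemptyChain (ElemAbelianPoset p G))
    (hc : c ∈ reducedChains p G) : g • c ∈ reducedChains p G := by
  rintro _ ⟨x, hx, rfl⟩
  exact (hc x hx).imp isSubcentral_smul_iff.2 isCentric_smul_iff.2

theorem reducedChains_subset_cappedChains : reducedChains p G ⊆ cappedChains p G :=
  fun _ hc x hx hxs => ⟨x, hx, le_rfl, hxs, (hc x hx).resolve_left hxs⟩

/-- Discarding the members that are neither subcentral nor centric never empties a capped chain: any
non-subcentral member lies below a centric one, which is kept. -/
theorem contractibleSpace_cappedChains [Finite G]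
    (h : ContractibleSpace (WithLowerSet (orbitSub G (reducedChains p G)))) :
    ContractibleSpace (WithLowerSet (orbitSub G (cappedChains p G))) := by
  refine contractibleSpace_orbitSub (cappedChains p G) (reducedChains p G)
    reducedChains_subset_cappedChains smul_mem_cappedChains
    (fun c d => d.carrier = {x ∈ c.carrier | IsSubcentral p x.1 ∨ IsCentric p x.1})
    ?_ ?_ ?_ ?_ (Or.inr ?_) h
  · intro c hc
    refine ⟨⟨_, ?_, c.isChain'.mono (Set.sep_subset _ _)⟩, fun x hx => hx.2, rfl⟩
    obtain ⟨x, hx⟩ := c.Nonempty'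
    by_cases hxs : IsSubcentral p x.1
    · exact ⟨x, hx, Or.inl hxs⟩
    · obtain ⟨y, hy, -, -, hyc⟩ := hc x hx hxs
      exact ⟨y, hy, Or.inr hyc⟩
  · intro c _ d d' hd hd'
    rw [NonemptyChain.ext (hd.trans hd'.symm)]
  · intro g c d hd
    ext x
    rw [mem_smul_chain, hd]
    refine and_congr mem_smul_chain.symm ?_
    rw [isSubcentral_smul_iff, isCentric_smul_iff]
  · intro c hc c' _ hcc d' hd'
    refine ⟨⟨{x ∈ c.carrier | IsSubcentral p x.1 ∨ IsCentric p x.1}, ?_,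
      c.isChain'.mono (Set.sep_subset _ _)⟩, rfl, ?_⟩
    · obtain ⟨x, hx⟩ := c.Nonempty'
      by_cases hxs : IsSubcentral p x.1
      · exact ⟨x, hx, Or.inl hxs⟩
      · obtain ⟨y, hy, -, -, hyc⟩ := hc x hx hxs
        exact ⟨y, hy, Or.inr hyc⟩
    · intro x hx
      change x ∈ d'.carrier
      rw [hd']
      exact ⟨hcc hx.1, hx.2⟩
  · intro c _ d hd x hx
    have hx' : x ∈ d.carrier := hx
    rw [hd] at hx'
    exact hx'.1

theorem contractibleSpace_univ [Fact p.Prime] [Finite G] (h : HasElementaryAbelianOfIndexLE p G)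
    (hc : ContractibleSpace (WithLowerSet (orbitSub G (cappedChains p G)))) :
    ContractibleSpace (WithLowerSet
      (orbitSub G (Set.univ : Set (NonemptyChain (ElemAbelianPoset p G))))) := by
  have hgreatest : ∀ c : NonemptyChain (ElemAbelianPoset p G),
      ∃ m ∈ c.carrier, ∀ x ∈ c.carrier, x ≤ m := fun c =>
    exists_greatest_of_isChain c.Nonempty' fun x hx y hy => c.comparable hx hy
  refine contractibleSpace_orbitSub Set.univ (cappedChains p G) (Set.subset_univ _)
    (fun _ _ _ => trivial)
    (fun c d => ((∀ x ∈ c.carrier, IsSubcentral p x.1) ∧ d = c) ∨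
      ∃ m ∈ c.carrier, (∀ x ∈ c.carrier, x ≤ m) ∧ ¬ IsSubcentral p m.1 ∧
        ∃ S : ElemAbelianPoset p G,
          IsSylowIn p (Subgroup.centralizer (m.1 : Set G)) S.1 ∧
          d.carrier = insert S c.carrier)
    ?_ ?_ ?_ ?_ (Or.inl ?_) hc
  · intro c _
    obtain ⟨m, hm, hmax⟩ := hgreatest c
    by_cases hms : IsSubcentral p m.1
    · exact ⟨c, fun x hx hxs => absurd (hms.mono (hmax x hx)) hxs,
        Or.inl ⟨fun x hx => hms.mono (hmax x hx), rfl⟩⟩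
    · obtain ⟨S, hS, hmS⟩ := exists_isSylowIn_ge m.2.1.isPGroup m.2.1.le_centralizer
      have hSe := isElementaryAbelian_of_isSylowIn_centralizer h m.2.1 hms hS
      let S' : ElemAbelianPoset p G := ⟨S, hSe, fun hb => m.2.2 (le_bot_iff.1 (hb ▸ hmS))⟩
      obtain ⟨d, hd⟩ := c.exists_insert S' fun x hx => Or.inl ((hmax x hx).trans hmS)
      refine ⟨d, ?_, Or.inr ⟨m, hm, hmax, hms, S', hS, hd⟩⟩
      intro x hx _
      refine ⟨S', hd ▸ Set.mem_insert _ _, ?_, fun hSs => hms (hSs.mono hmS),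
        isCentric_of_isSylowIn_centralizer m.2.1 hS hSe⟩
      rw [hd] at hx
      rcases hx with rfl | hx
      · exact le_rfl
      · exact (hmax x hx).trans hmS
  · rintro c - d d' (⟨hs, rfl⟩ | ⟨m, hm, hmax, hms, S, hS, hd⟩)
      (⟨hs', rfl⟩ | ⟨m', hm', hmax', hms', S', hS', hd'⟩)
    · rfl
    · exact absurd (hs m' hm') hms'
    · exact absurd (hs' m hm) hms
    · obtain rfl : m = m' := le_antisymm (hmax' m hm) (hmax m' hm')
      obtain ⟨k, hk, hkS⟩ := hS.exists_conj hS'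
      refine mk_eq_of_insert k (fun x hx => ?_) hd
        (by rw [hd', show k • S = S' from Subtype.ext hkS])
      -- The conjugating element centralizes the top member, hence fixes the whole chain.
      exact ElemAbelianPoset.smul_eq_of_mem_centralizer (centralizer_anti (hmax x hx) hk)
  · rintro g c d (⟨hs, rfl⟩ | ⟨m, hm, hmax, hms, S, hS, hd⟩)
    · refine Or.inl ⟨?_, rfl⟩
      rintro _ ⟨x, hx, rfl⟩
      exact isSubcentral_smul_iff.2 (hs x hx)
    · refine Or.inr ⟨g • m, Set.smul_mem_smul_set hm, ?_, mt isSubcentral_smul_iff.1 hms,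
        g • S, ?_, ?_⟩
      · rintro _ ⟨x, hx, rfl⟩
        exact CovariantClass.elim g (hmax x hx)
      · have := hS.aut_smul (MulAut.conj g)
        rwa [← centralizer_aut_smul] at this
      · rw [carrier_smul, hd, Set.smul_set_insert, carrier_smul]
  · rintro c - c' - hcc d' (⟨hs, rfl⟩ | ⟨m', hm', hmax', hms', S, hS, hd'⟩)
    · exact ⟨c, Or.inl ⟨fun x hx => hs x (hcc hx), rfl⟩, hcc⟩
    · obtain ⟨m, hm, hmax⟩ := hgreatest c
      have hcd : c'.carrier ⊆ d'.carrier := hd' ▸ Set.subset_insert _ _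
      -- A smaller chain with subcentral top is left unchanged; otherwise the same `S` can be
      -- adjoined to it.
      by_cases hms : IsSubcentral p m.1
      · exact ⟨c, Or.inl ⟨fun x hx => hms.mono (hmax x hx), rfl⟩,
          fun x hx => hcd (hcc hx)⟩
      · have hmm : m ≤ m' := hmax' m (hcc hm)
        have hmS : m' ≤ S := le_of_isSylowIn_centralizer m'.2.1 hS
        obtain ⟨d, hd⟩ := c.exists_insert S fun x hx =>
          Or.inl (((hmax x hx).trans hmm).trans hmS)
        refine ⟨d, Or.inr ⟨m, hm, hmax, hms, S,
          isSylowIn_centralizer_of_le h m.2.1 hms hmm m'.2.1 hS, hd⟩, ?_⟩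
        change d.carrier ⊆ d'.carrier
        rw [hd, hd']
        exact Set.insert_subset_insert hcc
  · rintro c - d (⟨-, rfl⟩ | ⟨m, -, -, -, S, -, hd⟩)
    · exact le_rfl
    · change c.carrier ⊆ d.carrier
      rw [hd]
      exact Set.subset_insert _ _

/-- The elements that stabilize every member of `c` and centralize the subcentral ones. -/
def chainStabilizer (c : NonemptyChain (ElemAbelianPoset p G)) : Subgroup G :=
  (⨅ x ∈ {x ∈ c.carrier | IsSubcentral p x.1}, Subgroup.centralizer (x.1 : Set G)) ⊓
    ⨅ x ∈ c.carrier, MulAction.stabilizer G x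

theorem mem_chainStabilizer {c : NonemptyChain (ElemAbelianPoset p G)} {g : G} :
    g ∈ chainStabilizer c ↔
      (∀ x ∈ c.carrier, IsSubcentral p x.1 → g ∈ Subgroup.centralizer (x.1 : Set G)) ∧
      ∀ x ∈ c.carrier, g • x = x := by
  simp [chainStabilizer, Subgroup.mem_iInf]

theorem chainStabilizer_anti {c d : NonemptyChain (ElemAbelianPoset p G)} (h : c ≤ d) :
    chainStabilizer d ≤ chainStabilizer c := by
  intro g hg
  rw [mem_chainStabilizer] at hg ⊢
  exact ⟨fun x hx => hg.1 x (h hx), fun x hx => hg.2 x (h hx)⟩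

theorem chainStabilizer_smul (g : G) (c : NonemptyChain (ElemAbelianPoset p G)) :
    chainStabilizer (g • c) = MulAut.conj g • chainStabilizer c := by
  ext k
  rw [mem_aut_smul_iff, ← map_inv, MulAut.conj_apply, inv_inv, mem_chainStabilizer,
    mem_chainStabilizer]
  have hcen : ∀ x : ElemAbelianPoset p G, k ∈ Subgroup.centralizer ((g • x).1 : Set G) ↔
      g⁻¹ * k * g ∈ Subgroup.centralizer (x.1 : Set G) := by
    intro x
    rw [ElemAbelianPoset.coe_smul, centralizer_aut_smul, mem_aut_smul_iff, ← map_inv,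
      MulAut.conj_apply, inv_inv]
  have hfix : ∀ x : ElemAbelianPoset p G, k • g • x = g • x ↔ (g⁻¹ * k * g) • x = x := by
    intro x
    rw [mul_smul, mul_smul, inv_smul_eq_iff]
  constructor
  · intro h
    exact ⟨fun x hx hxs => (hcen x).1
      (h.1 _ (Set.smul_mem_smul_set hx) (isSubcentral_smul_iff.2 hxs)),
      fun x hx => (hfix x).1 (h.2 _ (Set.smul_mem_smul_set hx))⟩
  · intro h
    constructor
    · rintro _ ⟨x, hx, rfl⟩ hxs
      exact (hcen x).2 (h.1 x hx (isSubcentral_smul_iff.1 hxs))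
    · rintro _ ⟨x, hx, rfl⟩
      exact (hfix x).2 (h.2 x hx)

/-- A centric member is maximal among elementary abelian subgroups, so a reduced chain has at most
one non-subcentral member. -/
theorem eq_of_mem_reducedChains {c : NonemptyChain (ElemAbelianPoset p G)}
    (hc : c ∈ reducedChains p G) {S x : ElemAbelianPoset p G} (hS : S ∈ c.carrier)
    (hSs : ¬ IsSubcentral p S.1) (hx : x ∈ c.carrier) (hxs : ¬ IsSubcentral p x.1) : x = S := by
  rcases c.comparable hx hS with h | h
  · exact Subtype.ext (((hc x hx).resolve_left hxs).eq_of_le S.2.1 h)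
  · exact (Subtype.ext (((hc S hS).resolve_left hSs).eq_of_le x.2.1 h)).symm

theorem le_of_isSubcentral {c : NonemptyChain (ElemAbelianPoset p G)}
    {S x : ElemAbelianPoset p G} (hS : S ∈ c.carrier)
    (hSs : ¬ IsSubcentral p S.1) (hx : x ∈ c.carrier) (hxs : IsSubcentral p x.1) : x ≤ S :=
  (c.comparable hx hS).resolve_right fun h => hSs (hxs.mono h)

theorem centralizer_of_le_omegaCenter {A P : Subgroup G} (h : A ≤ omegaCenter p P) :
    P ≤ Subgroup.centralizer (A : Set G) :=
  fun y hy _ ha => (h ha).2.1 y hy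

variable [Fact p.Prime] [Finite G]

/-- The right side does not involve `P`, so `Ω₁(Z(P))` depends only on the chain and on `Q`. It
centralizes `S` and `Q`, both inside `P`, and `S` is centric, which gives one inclusion. The other
is `mem_omegaCenter_of_commute_normalizer`, since `N_P(S) ≤ Q`. -/
theorem omegaCenter_eq_inf_centralizer (h : HasElementaryAbelianOfIndexLE p G)
    {c : NonemptyChain (ElemAbelianPoset p G)} (hc : c ∈ reducedChains p G) {P Q : Subgroup G}
    (hP : IsSylowIn p ⊤ P) (hcP : ∀ x ∈ c.carrier, IsSubcentral p x.1 → x.1 ≤ omegaCenter p P)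
    (hQ : IsSylowIn p (chainStabilizer c) Q) (hQP : Q ≤ P) {S : ElemAbelianPoset p G}
    (hS : S ∈ c.carrier) (hSs : ¬ IsSubcentral p S.1) :
    omegaCenter p P = S.1 ⊓ Subgroup.centralizer (Q : Set G) := by
  have hScen : IsCentric p S.1 := (hc S hS).resolve_left hSs
  have hstab : ∀ g, (∀ x ∈ c.carrier, IsSubcentral p x.1 →
      g ∈ Subgroup.centralizer (x.1 : Set G)) → g • S = S → g ∈ chainStabilizer c := by
    refine fun g h1 h2 => mem_chainStabilizer.2 ⟨h1, fun x hx => ?_⟩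
    by_cases hxs : IsSubcentral p x.1
    · exact ElemAbelianPoset.smul_eq_of_mem_centralizer (h1 x hx hxs)
    · rwa [eq_of_mem_reducedChains hc hS hSs hx hxs]
  -- `S` lies in the chain stabilizer and is normalized by it, so it lies in each of its Sylow
  -- subgroups.
  have hSQ : S.1 ≤ Q := by
    refine hQ.le_of_normalized S.2.1.isPGroup (fun g hg => hstab g (fun x hx hxs => ?_) ?_)
      fun g hg => ?_
    · exact centralizer_anti (le_of_isSubcentral hS hSs hx hxs) (S.2.1.le_centralizer hg)
    · exact ElemAbelianPoset.smul_eq_of_mem_centralizer (S.2.1.le_centralizer hg)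
    · have := congrArg Subtype.val ((mem_chainStabilizer.1 hg).2 S hS)
      exact mem_normalizer_iff_conj_smul_eq.2 this
  have hSP := hSQ.trans hQP
  apply le_antisymm
  · refine le_inf (hScen _ (isElementaryAbelian_omegaCenter P).isPGroup ?_) ?_
    · exact le_centralizer_symm (hSP.trans (centralizer_of_le_omegaCenter le_rfl))
    · exact le_centralizer_symm (hQP.trans (centralizer_of_le_omegaCenter le_rfl))
  · rintro x ⟨hxS, hxQ⟩
    obtain ⟨V, hVP, hV, hcard⟩ := h P hP
    refine mem_omegaCenter_of_commute_normalizer hP.prop.1 hVP hcard hV hSP S.2.1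
      (fun hSO => hSs ⟨P, hP, hSO⟩) (fun z hz hzS => ?_) hxS fun z hz hzN => ?_
    · exact hScen (P ⊓ Subgroup.centralizer (S.1 : Set G)) (hP.prop.1.to_le inf_le_left)
        inf_le_right ⟨hz, hzS⟩
    · have hzL : z ∈ chainStabilizer c := by
        refine hstab z (fun y hy hys => centralizer_of_le_omegaCenter (hcP y hy hys) hz) ?_
        exact Subtype.ext (mem_normalizer_iff_conj_smul_eq.1 hzN)
      -- `P ⊓ chainStabilizer c` is a `p`-group containing the Sylow subgroup `Q`, hence equal to
      -- it.
      have hzQ : z ∈ Q := hQ.le_of_ge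
        (y := P ⊓ chainStabilizer c) ⟨hP.prop.1.to_le inf_le_left, inf_le_right⟩
        (le_inf hQP hQ.prop.2) ⟨hz, hzL⟩
      exact (hxQ z hzQ).symm

/-- For the largest subcentral member `m`, the group `C_G(m)` contains a full Sylow subgroup of `G`.
So a Sylow subgroup of `C_G(m)` containing `T` is Sylow in `G`, and `m` is central in it. -/
theorem exists_sylow_of_chain (c : NonemptyChain (ElemAbelianPoset p G)) {T : Subgroup G}
    (hT : IsPGroup p T)
    (hTc : ∀ x ∈ c.carrier, IsSubcentral p x.1 → T ≤ Subgroup.centralizer (x.1 : Set G)) :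
    ∃ P, IsSylowIn p ⊤ P ∧ T ≤ P ∧
      ∀ x ∈ c.carrier, IsSubcentral p x.1 → x.1 ≤ omegaCenter p P := by
  rcases Set.eq_empty_or_nonempty {x ∈ c.carrier | IsSubcentral p x.1} with he | hne
  · obtain ⟨P, hP, hTP⟩ := exists_isSylowIn_ge hT le_top
    refine ⟨P, hP, hTP, fun x hx hxs => ?_⟩
    have : x ∈ {x ∈ c.carrier | IsSubcentral p x.1} := ⟨hx, hxs⟩
    rw [he] at this
    exact this.elim
  · obtain ⟨m, ⟨hm, hms⟩, hmax⟩ := exists_greatest_of_isChain hne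
      fun x hx y hy => c.comparable hx.1 hy.1
    obtain ⟨P, hP, hTP⟩ := exists_isSylowIn_ge hT (hTc m hm hms)
    obtain ⟨P₀, hP₀, hmP₀⟩ := hms
    refine ⟨P, hP₀.of_le (centralizer_of_le_omegaCenter hmP₀) le_top hP, hTP, fun x hx hxs => ?_⟩
    refine le_trans (hmax x ⟨hx, hxs⟩) fun y hy => ⟨?_, fun z hz => ?_, m.2.1.2 y hy⟩
    · exact le_of_isSylowIn_centralizer m.2.1 hP hy
    · exact hP.prop.2 hz y hy

theorem card_omegaCenter_eq {P Q : Subgroup G} (hP : IsSylowIn p ⊤ P) (hQ : IsSylowIn p ⊤ Q) :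
    Nat.card (omegaCenter p P) = Nat.card (omegaCenter p Q) := by
  obtain ⟨g, -, rfl⟩ := hP.exists_conj hQ
  rw [omegaCenter_aut_smul]
  exact Nat.card_congr (Subgroup.equivSMul (MulAut.conj g) (omegaCenter p P)).toEquiv

theorem exists_omegaCenter_eq (hpG : p ∣ Nat.card G) {P : Subgroup G} (hP : IsSylowIn p ⊤ P) :
    ∃ w : ElemAbelianPoset p G, w.1 = omegaCenter p P := by
  refine ⟨⟨_, isElementaryAbelian_omegaCenter P, omegaCenter_ne_bot hP.prop.1 ?_⟩, rfl⟩
  rintro rfl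
  obtain ⟨R⟩ : Nonempty (Sylow p G) := inferInstance
  exact R.ne_bot_of_dvd_card hpG (hP.eq_of_le (isSylowIn_top R).prop bot_le).symm

theorem contractibleSpace_reducedChains (h : HasElementaryAbelianOfIndexLE p G)
    (hpG : p ∣ Nat.card G)
    (hc : ContractibleSpace (WithLowerSet (orbitSub G (omegaChains p G)))) :
    ContractibleSpace (WithLowerSet (orbitSub G (reducedChains p G))) := by
  refine contractibleSpace_orbitSub (reducedChains p G) (omegaChains p G) (fun _ hc => hc.1)
    smul_mem_reducedChains
    (fun c d => ∃ P, IsSylowIn p ⊤ P ∧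
      (∀ x ∈ c.carrier, IsSubcentral p x.1 → x.1 ≤ omegaCenter p P) ∧
      (∀ S ∈ c.carrier, ¬ IsSubcentral p S.1 → ∃ Q, IsSylowIn p (chainStabilizer c) Q ∧
        omegaCenter p P = S.1 ⊓ Subgroup.centralizer (Q : Set G)) ∧
      ∃ w : ElemAbelianPoset p G, w.1 = omegaCenter p P ∧ d.carrier = insert w c.carrier)
    ?_ ?_ ?_ ?_ (Or.inl ?_) hc
  · intro c hcr
    obtain ⟨Q, hQ, -⟩ := exists_isSylowIn_ge (IsPGroup.of_bot (p := p) (G := G))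
      (bot_le : ⊥ ≤ chainStabilizer c)
    obtain ⟨P, hP, hQP, hcP⟩ := exists_sylow_of_chain c hQ.prop.1 fun x hx hxs =>
      hQ.prop.2.trans fun g hg => (mem_chainStabilizer.1 hg).1 x hx hxs
    obtain ⟨w, hw⟩ := exists_omegaCenter_eq hpG hP
    have hS := fun S hS hSs => omegaCenter_eq_inf_centralizer h hcr hP hcP hQ hQP (S := S) hS hSs
    obtain ⟨d, hd⟩ := c.exists_insert w fun x hx => by
      by_cases hxs : IsSubcentral p x.1
      · exact Or.inl (show x.1 ≤ w.1 from hw ▸ hcP x hx hxs)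
      · refine Or.inr (show w.1 ≤ x.1 from ?_)
        rw [hw, hS x hx hxs]
        exact inf_le_left
    refine ⟨d, ⟨?_, P, hP, w, hd ▸ Set.mem_insert _ _, hw⟩, P, hP, hcP,
      fun S hSc hSs => ⟨Q, hQ, hS S hSc hSs⟩, w, hw, hd⟩
    intro x hx
    rw [hd] at hx
    rcases hx with rfl | hx
    · exact Or.inl ⟨P, hP, hw.le⟩
    · exact hcr x hx
  · rintro c hcr d d' ⟨P, hP, hcP, hcS, w, hw, hd⟩ ⟨P', hP', hcP', hcS', w', hw', hd'⟩
    suffices hk : ∃ k ∈ chainStabilizer c, MulAut.conj k • omegaCenter p P = omegaCenter p P' by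
      obtain ⟨k, hk, hkP⟩ := hk
      refine mk_eq_of_insert k (mem_chainStabilizer.1 hk).2 hd ?_
      rw [hd', show k • w = w' from Subtype.ext (by
        rw [ElemAbelianPoset.coe_smul, hw, hkP, hw'])]
    -- If all members are subcentral, `P` and `P'` are both Sylow in the chain stabilizer. Otherwise
    -- an element of the stabilizer conjugates `Q` to `Q'` and normalizes `S`.
    by_cases hall : ∀ x ∈ c.carrier, IsSubcentral p x.1
    · have key : ∀ R, IsSylowIn p ⊤ R →
          (∀ x ∈ c.carrier, IsSubcentral p x.1 → x.1 ≤ omegaCenter p R) →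
          IsSylowIn p (chainStabilizer c) R := by
        intro R hR hcR
        refine hR.mono le_top fun g hg => ?_
        have hg' : ∀ x ∈ c.carrier, g ∈ Subgroup.centralizer (x.1 : Set G) := fun x hx =>
          centralizer_of_le_omegaCenter (hcR x hx (hall x hx)) hg
        exact mem_chainStabilizer.2 ⟨fun x hx _ => hg' x hx, fun x hx =>
          ElemAbelianPoset.smul_eq_of_mem_centralizer (hg' x hx)⟩
      obtain ⟨k, hk, rfl⟩ := (key P hP hcP).exists_conj (key P' hP' hcP')
      exact ⟨k, hk, (omegaCenter_aut_smul _ _).symm⟩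
    · push Not at hall
      obtain ⟨S, hS, hSs⟩ := hall
      obtain ⟨Q, hQ, hPQ⟩ := hcS S hS hSs
      obtain ⟨Q', hQ', hPQ'⟩ := hcS' S hS hSs
      obtain ⟨k, hk, rfl⟩ := hQ.exists_conj hQ'
      refine ⟨k, hk, ?_⟩
      rw [hPQ, hPQ', Subgroup.smul_inf, centralizer_aut_smul]
      congr 1
      exact congrArg Subtype.val ((mem_chainStabilizer.1 hk).2 S hS)
  · rintro g c d ⟨P, hP, hcP, hcS, w, hw, hd⟩
    refine ⟨MulAut.conj g • P, hP.conj_top g, ?_, ?_, g • w, ?_, ?_⟩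
    · rintro _ ⟨x, hx, rfl⟩ hxs
      rw [omegaCenter_aut_smul]
      exact Subgroup.pointwise_smul_le_pointwise_smul_iff.2
        (hcP x hx (isSubcentral_smul_iff.1 hxs))
    · rintro _ ⟨S, hS, rfl⟩ hSs
      obtain ⟨Q, hQ, hPQ⟩ := hcS S hS (mt isSubcentral_smul_iff.2 hSs)
      refine ⟨MulAut.conj g • Q, ?_, ?_⟩
      · rw [chainStabilizer_smul]
        exact hQ.aut_smul _
      · rw [omegaCenter_aut_smul, hPQ, Subgroup.smul_inf, centralizer_aut_smul]
        rfl
    · rw [omegaCenter_aut_smul, ← hw]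
      rfl
    · rw [carrier_smul, hd, Set.smul_set_insert, carrier_smul]
  · rintro c hcr c' _ hcc d' ⟨P, hP, hcP, hcS, w, hw, hd'⟩
    have hcc' : c.carrier ⊆ c'.carrier := hcc
    obtain ⟨d, hd⟩ := c.exists_insert w fun x hx => d'.comparable
      (hd' ▸ Set.mem_insert_of_mem _ (hcc' hx)) (hd' ▸ Set.mem_insert _ _)
    refine ⟨d, ⟨P, hP, fun x hx => hcP x (hcc' hx), fun S hS hSs => ?_, w, hw, hd⟩, ?_⟩
    · obtain ⟨Q', hQ', hPQ'⟩ := hcS S (hcc' hS) hSs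
      obtain ⟨Q, hQ, hQQ⟩ := exists_isSylowIn_ge hQ'.prop.1
        (hQ'.prop.2.trans (chainStabilizer_anti hcc))
      obtain ⟨R, hR, hQR, hcR⟩ := exists_sylow_of_chain c hQ.prop.1 fun x hx hxs =>
        hQ.prop.2.trans fun g hg => (mem_chainStabilizer.1 hg).1 x hx hxs
      have hRQ := omegaCenter_eq_inf_centralizer h hcr hR hcR hQ hQR hS hSs
      refine ⟨Q, hQ, ?_⟩
      -- Passing to a subchain enlarges the stabilizer, so `S ∩ C_G(Q) ≤ S ∩ C_G(Q')`. Both are `Ω₁`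
      -- of centers of Sylow subgroups of `G`, so equal orders force equality, and the same `w`
      -- serves both chains.
      have hle : omegaCenter p R ≤ omegaCenter p P := by
        rw [hRQ, hPQ']
        exact inf_le_inf_left _ (centralizer_anti hQQ)
      rw [← hRQ]
      exact (Subgroup.eq_of_le_of_card_ge hle (card_omegaCenter_eq hP hR).le).symm
    · change d.carrier ⊆ d'.carrier
      rw [hd, hd']
      exact Set.insert_subset_insert hcc'
  · rintro c - d ⟨P, -, -, -, w, -, hd⟩
    change c.carrier ⊆ d.carrier
    rw [hd]
    exact Set.subset_insert _ _

theorem contractibleSpace_omegaChains (hpG : p ∣ Nat.card G) :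
    ContractibleSpace (WithLowerSet (orbitSub G (omegaChains p G))) := by
  obtain ⟨P⟩ : Nonempty (Sylow p G) := inferInstance
  have hsing : ∀ {Q : Subgroup G}, IsSylowIn p ⊤ Q → ∀ {w : ElemAbelianPoset p G},
      w.1 = omegaCenter p Q →
      (⟨{w}, Set.singleton_nonempty w, IsChain.singleton⟩ :
        NonemptyChain (ElemAbelianPoset p G)) ∈ omegaChains p G := by
    intro Q hQ w hw
    refine ⟨?_, Q, hQ, w, rfl, hw⟩
    rintro x rfl
    exact Or.inl ⟨Q, hQ, hw.le⟩
  obtain ⟨w, hw⟩ := exists_omegaCenter_eq hpG (isSylowIn_top P)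
  refine contractibleSpace_of_bot ⟨OrbitSpace.mk G _, _, hsing (isSylowIn_top P) hw, rfl⟩ ?_
  rintro ⟨_, c, ⟨-, Q, hQ, v, hv, hvQ⟩, rfl⟩
  obtain ⟨k, -, hk⟩ := (isSylowIn_top P).exists_conj hQ
  have hkv : k • w = v := Subtype.ext (by
    rw [ElemAbelianPoset.coe_smul, hw, hvQ, ← hk, omegaCenter_aut_smul])
  refine ⟨⟨{v}, Set.singleton_nonempty v, IsChain.singleton⟩, c, ?_, rfl, ?_⟩
  · refine OrbitSpace.mk_eq_iff.2 ⟨k, NonemptyChain.ext ?_⟩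
    rw [carrier_smul, Set.smul_set_singleton, hkv]
  · exact Set.singleton_subset_iff.2 hv

end Reductions

end WebbPosets

theorem mainTheorem3 (p : ℕ) [Fact p.Prime] (G : Type*) [Group G] [Finite G]
    (hpG : p ∣ Nat.card G) (P : Sylow p G)
    (hdiff : (WebbPosets.pRank p G : ℤ) - WebbPosets.pRank p (WebbPosets.sylowOmega P) ≤ 2)
    (hrank : (WebbPosets.pRank p G : ℝ) ≥ Real.logb p (Nat.card P) - 1) :
    Finite (WebbPosets.ElemAbelianOrbitSpace p G) ∧
      ContractibleSpace (WebbPosets.ElemAbelianOrbitSpace p G) := by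
  have h : WebbPosets.HasElementaryAbelianOfIndexLE p G := fun _ hQ =>
    WebbPosets.exists_elementaryAbelian_of_logb_le P hrank hQ
  refine ⟨inferInstanceAs
    (Finite (WebbPosets.OrbitSpace G (NonemptyChain (WebbPosets.ElemAbelianPoset p G)))), ?_⟩
  exact WebbPosets.contractibleSpace_orbitSpace <| WebbPosets.contractibleSpace_univ h <|
    WebbPosets.contractibleSpace_cappedChains <|
    WebbPosets.contractibleSpace_reducedChains h hpG <|
    WebbPosets.contractibleSpace_omegaChains hpG
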